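/- Let $\mathbb K$ be $\mathbb R$ or $\mathbb C$. For $1\le p\le\infty$ let $q$ be the conjugate exponent, $\frac1p+\frac1q=1$. For a Banach space $E$ over $\mathbb K$ let $\ell_p^s(E)$ be the space of sequences $x=(x_n)$ in $E$ with $\|x\|_p^s=(\sum_n\|x_n\|^p)^{1/p}<\infty$ if $p<\infty$; if $p=\infty$, use instead the space $c_0^s(E)$ of norm-null sequences with $\|x\|_\infty^s=\sup_n\|x_n\|$. For such $x$ put $E_x:\ell_q\to E$, $E_x(\alpha)=\sum_n\alpha_nx_n$. A set $K\subseteq E$ is relatively $p$-compact if $K\subseteq E_x(B_{\ell_q})$ for some such $x$. A bounded operator $S:E\to F$ is $p$-compact, $S\in K_p(E,F)$, if it maps bounded sets to relatively $p$-compact sets, and then $\kappa_p(S)=\inf\{\|y\|_p^s : S(B_E)\subseteq E_y(B_{\ell_q})\}$, the infimum over $y\in\ell_p^s(F)$ (over $y\in c_0^s(F)$ if $p=\infty$). Let $K_p^d(E,F)$ be the set of bounded operators $T:E\to F$ whose adjoint $T^*:F^*\to E^*$ is $p$-compact, with $\kappa_p^d(T)=\kappa_p(T^*)$. A Banach space $E$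 is a $P_\lambda$ space if for every Banach space $W$ containing $E$ isometrically as a subspace there is a projection of $W$ onto $E$ of norm at most $\lambda$. **Theorem.** Let $X,Y,Z$ be Banach spaces over $\mathbb K$ such that $Z$ contains $X$ isometrically as a subspace, let $\lambda\ge1$, and suppose that $X^{**}$ is a $P_\lambda$ space. Let $1\le p\le\infty$. Then every $T\in K_p^d(X,Y)$ has an extension $\widetilde T\in K_p^d(Z,Y)$, that is, $\widetilde T|_X=T$, with $\kappa_p^d(\widetilde T)\le\lambda\,\kappa_p^d(T)$. -/

import Mathlib

open Filter Topology
open scoped ENNReal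

/-- The space `ℓ_p^s(E)` of strongly `p`-summable sequences in `E` for `1 ≤ p < ∞`; for `p = ∞` the
space `c_0^s(E)` of norm-null sequences. The norm of `ℓ_p^s(E)`, respectively the sup norm of
`c_0^s(E)`, is the norm of `lp (fun _ : ℕ => E) p`. -/
def strongSeq (p : ℝ≥0∞) (E : Type*) [NormedAddCommGroup E] : Set (lp (fun _ : ℕ => E) p) :=
  {x | p = ∞ → Tendsto (fun n => x n) atTop (𝓝 0)}

/-- The image `E_x(B_{ℓ_q})` of the closed unit ball of the scalar sequence space `ℓ_q`,
`1/p + 1/q = 1`, under the operator `E_x : α ↦ ∑ n, α n • x n`. -/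
def seqBallImage (𝕜 : Type*) [RCLike 𝕜] (p : ℝ≥0∞) {E : Type*} [NormedAddCommGroup E]
    [NormedSpace 𝕜 E] (x : ℕ → E) : Set E :=
  {v | ∃ α : lp (fun _ : ℕ => 𝕜) (ENNReal.conjExponent p),
    ‖α‖ ≤ 1 ∧ HasSum (fun n => α n • x n) v}

/-- Relatively `p`-compact subsets of `E`. -/
def IsRelPCompact (𝕜 : Type*) [RCLike 𝕜] (p : ℝ≥0∞) {E : Type*} [NormedAddCommGroup E]
    [NormedSpace 𝕜 E] (K : Set E) : Prop :=
  ∃ x ∈ strongSeq p E, K ⊆ seqBallImage 𝕜 p x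

/-- `K_p(E, F)`: the bounded operators that map bounded sets to relatively `p`-compact sets. -/
def pCompactOps (𝕜 : Type*) [RCLike 𝕜] (p : ℝ≥0∞) (E F : Type*) [NormedAddCommGroup E]
    [NormedSpace 𝕜 E] [NormedAddCommGroup F] [NormedSpace 𝕜 F] : Set (E →L[𝕜] F) :=
  {T | ∀ S : Set E, Bornology.IsBounded S → IsRelPCompact 𝕜 p (T '' S)}

/-- The norm `κ_p(T) = inf {‖y‖_p^s : T(B_E) ⊆ E_y(B_{ℓ_q})}`, for `T ∈ K_p(E, F)`. -/
noncomputable def kappa {𝕜 : Type*} [RCLike 𝕜] {E F : Type*} [NormedAddCommGroup E]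
    [NormedSpace 𝕜 E] [NormedAddCommGroup F] [NormedSpace 𝕜 F]
    (p : ℝ≥0∞) (T : E →L[𝕜] F) : ℝ :=
  sInf {r | ∃ y ∈ strongSeq p F, T '' Metric.closedBall 0 1 ⊆ seqBallImage 𝕜 p y ∧ r = ‖y‖}

/-- The Banach space adjoint `T* : F* → E*`, `φ ↦ φ ∘ T`. -/
noncomputable def banachAdjoint {𝕜 : Type*} [RCLike 𝕜] {E F : Type*} [NormedAddCommGroup E]
    [NormedSpace 𝕜 E] [NormedAddCommGroup F] [NormedSpace 𝕜 F]
    (T : E →L[𝕜] F) : StrongDual 𝕜 F →L[𝕜] StrongDual 𝕜 E :=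
  (ContinuousLinearMap.compL 𝕜 E F 𝕜).flip T

/-- `K_p^d(E, F)`, the dual ideal of `K_p`: the bounded operators whose adjoint is `p`-compact. -/
def dualPCompactOps (𝕜 : Type*) [RCLike 𝕜] (p : ℝ≥0∞) (E F : Type*) [NormedAddCommGroup E]
    [NormedSpace 𝕜 E] [NormedAddCommGroup F] [NormedSpace 𝕜 F] : Set (E →L[𝕜] F) :=
  {T | banachAdjoint T ∈ pCompactOps 𝕜 p (StrongDual 𝕜 F) (StrongDual 𝕜 E)}

/-- `κ_p^d(T) = κ_p(T*)`. -/
noncomputable def kappaDual {𝕜 : Type*} [RCLike 𝕜] {E F : Type*} [NormedAddCommGroup E]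
    [NormedSpace 𝕜 E] [NormedAddCommGroup F] [NormedSpace 𝕜 F]
    (p : ℝ≥0∞) (T : E →L[𝕜] F) : ℝ :=
  kappa p (banachAdjoint T)

universe u v

/-- `E` is a `P_λ` space over `𝕜`: in every Banach space `W` that contains `E` isometrically, `E` is
the range of a projection of norm at most `lam`. The inclusion is a linear isometry `j`, and a
projection onto `E` is a bounded left inverse `P` of `j`. -/
def IsPSpace (𝕜 : Type v) [RCLike 𝕜] (lam : ℝ) (E : Type u) [NormedAddCommGroup E]
    [NormedSpace 𝕜 E] : Prop :=
  ∀ (W : Type u) [NormedAddCommGroup W] [NormedSpace 𝕜 W] [CompleteSpace W] (j : E →ₗᵢ[𝕜] W),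
    ∃ P : W →L[𝕜] E, (∀ x, P (j x) = x) ∧ ‖P‖ ≤ lam

/-!
Write `J` for canonical embeddings into biduals. The proof rests on two facts.

* Since `X**` is a `P_λ` space, there is an operator `V : X* → Z*` of norm at most `λ` which assigns
  to every functional on `X` an extension to `Z` (`IsPSpace.exists_extension`). To obtain it, embed
  `X**` isometrically into the space of bounded functions on the unit ball of `X*`, extend
  `J : X → X**` coordinatewise to `Z` by Hahn-Banach, project back onto `X**`, and exchange the
  arguments of the resulting operator `Z → X**`.
* Since `T*` is `p`-compact, `T**` maps `X**` into `J(Y)` (`exists_inclusion_eq_bidual_apply`). Up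
  to a small error, the elements of `T*(B_{Y*})` are combinations, with coefficients bounded by `1`,
  of finitely many functionals, and Helly's theorem (`exists_norm_le_apply_approx`) provides an
  `x : X` that approximates a given `ξ : X**` on those functionals. Hence `T** ξ` is a norm limit of
  elements `J (T x)`, and `J(Y)` is closed.

By the second fact, applied to the functionals `φ ↦ V φ z` on `X*`, the operator `V ∘ T*` is the
adjoint of an operator `T' : Z → Y` (`exists_banachAdjoint_eq`). It extends `T` because `V` extends
functionals, and `V ∘ T*` is `p`-compact with `κ_p(V ∘ T*) ≤ λ κ_p(T*)` by the ideal property of the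
`p`-compact operators (`comp_mem_pCompactOps`, `kappa_comp_le`).
-/

/-! ### Composition with a bounded operator -/

section Ideal

variable {𝕜 : Type*} [RCLike 𝕜] {p : ℝ≥0∞} {E F G : Type*}
  [NormedAddCommGroup E] [NormedSpace 𝕜 E] [NormedAddCommGroup F] [NormedSpace 𝕜 F]
  [NormedAddCommGroup G] [NormedSpace 𝕜 G]

/-- An operator `V` of norm at most `c` sends `E_y(B_{ℓ_q})` into `E_{Vy}(B_{ℓ_q})`, where
`‖Vy‖ ≤ c ‖y‖`. -/
lemma exists_strongSeq_image_subset (hp : 1 ≤ p) (V : F →L[𝕜] G) {c : ℝ} (hV : ‖V‖ ≤ c)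
    {y : lp (fun _ : ℕ => F) p} (hy : y ∈ strongSeq p F) :
    ∃ w ∈ strongSeq p G, ‖w‖ ≤ c * ‖y‖ ∧ V '' seqBallImage 𝕜 p y ⊆ seqBallImage 𝕜 p w := by
  have hc : 0 ≤ c := (norm_nonneg V).trans hV
  have hp0 : p ≠ 0 := (zero_lt_one.trans_le hp).ne'
  have hle : ∀ n, ‖V (y n)‖ ≤ ‖((c : 𝕜) • y) n‖ := fun n => by
    rw [lp.coeFn_smul, Pi.smul_apply, norm_smul, RCLike.norm_of_nonneg hc]
    exact V.le_of_opNorm_le hV _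
  refine ⟨⟨fun n => V (y n), (lp.memℓp ((c : 𝕜) • y)).norm.mono hle⟩, fun h => ?_, ?_, ?_⟩
  · simpa [Function.comp_def] using (V.continuous.tendsto 0).comp (hy h)
  · calc _ ≤ ‖(c : 𝕜) • y‖ := lp.norm_mono hp0 hle
      _ ≤ ‖(c : 𝕜)‖ * ‖y‖ := lp.norm_const_smul_le hp0 _ _
      _ = c * ‖y‖ := by rw [RCLike.norm_of_nonneg hc]
  · rintro _ ⟨v, ⟨α, hα, hv⟩, rfl⟩
    exact ⟨α, hα, by simpa [Function.comp_def] using hv.mapL V⟩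

lemma comp_mem_pCompactOps (hp : 1 ≤ p) (V : F →L[𝕜] G) {T : E →L[𝕜] F}
    (hT : T ∈ pCompactOps 𝕜 p E F) : V.comp T ∈ pCompactOps 𝕜 p E G := by
  intro s hs
  obtain ⟨y, hy, hsub⟩ := hT s hs
  obtain ⟨w, hw, -, hVw⟩ := exists_strongSeq_image_subset hp V le_rfl hy
  refine ⟨w, hw, ?_⟩
  rw [ContinuousLinearMap.coe_comp, Set.image_comp]
  exact (Set.image_mono hsub).trans hVw

lemma kappa_comp_le (hp : 1 ≤ p) (V : F →L[𝕜] G) {c : ℝ} (hc : 0 < c) (hV : ‖V‖ ≤ c)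
    {T : E →L[𝕜] F} (hT : T ∈ pCompactOps 𝕜 p E F) :
    kappa p (V.comp T) ≤ c * kappa p T := by
  rw [← div_le_iff₀' hc]
  refine le_csInf ?_ ?_
  · obtain ⟨y, hy, hsub⟩ := hT _ Metric.isBounded_closedBall
    exact ⟨_, y, hy, hsub, rfl⟩
  · rintro _ ⟨y, hy, hsub, rfl⟩
    obtain ⟨w, hw, hwy, hVw⟩ := exists_strongSeq_image_subset hp V hV hy
    rw [div_le_iff₀' hc]
    refine le_trans (csInf_le ⟨0, ?_⟩ ⟨w, hw, ?_, rfl⟩) hwy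
    · rintro _ ⟨z, -, -, rfl⟩
      exact lp.norm_nonneg' z
    · rw [ContinuousLinearMap.coe_comp, Set.image_comp]
      exact (Set.image_mono hsub).trans hVw

end Ideal

/-! ### Approximation of relatively `p`-compact sets -/

section Tail

variable {𝕜 : Type*} [RCLike 𝕜] {p : ℝ≥0∞} {E : Type*} [NormedAddCommGroup E] [NormedSpace 𝕜 E]

lemma exists_norm_sub_sum_single_le (hp : 1 ≤ p) {x : lp (fun _ : ℕ => E) p}
    (hx : x ∈ strongSeq p E) {ε : ℝ} (hε : 0 < ε) :
    ∃ N, ‖x - ∑ n ∈ Finset.range N, lp.single p n (x n)‖ ≤ ε := by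
  have : Fact (1 ≤ p) := ⟨hp⟩
  by_cases hpt : p = ∞
  · subst hpt
    obtain ⟨N, hN⟩ := Metric.tendsto_atTop.1 (hx rfl) ε hε
    refine ⟨N, lp.norm_le_of_forall_le hε.le fun n => ?_⟩
    rw [lp.coeFn_sub, Pi.sub_apply, lp.coeFn_sum, Finset.sum_apply]
    simp only [lp.coeFn_single, Finset.sum_pi_single]
    split_ifs with h
    · simpa using hε.le
    · rw [sub_zero]
      simpa using (hN n (by simpa using h)).le
  · have h := (lp.hasSum_single hpt x).tendsto_sum_nat
    obtain ⟨N, hN⟩ := Metric.tendsto_atTop.1 h ε hε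
    refine ⟨N, ?_⟩
    rw [norm_sub_rev, ← dist_eq_norm]
    exact (hN N le_rfl).le

/-- **Hölder's inequality** for the series `∑ n, α n • x n`. -/
lemma norm_le_of_hasSum_smul [CompleteSpace E] (hp : 1 ≤ p) (x : lp (fun _ : ℕ => E) p)
    (α : lp (fun _ : ℕ => 𝕜) (ENNReal.conjExponent p)) {v : E}
    (hv : HasSum (fun n => α n • x n) v) : ‖v‖ ≤ ‖x‖ * ‖α‖ := by
  have : Fact (1 ≤ p) := ⟨hp⟩
  have : Fact (1 ≤ ENNReal.conjExponent p) := ⟨le_self_add⟩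
  have hB : ∀ _ : ℕ, ‖(ContinuousLinearMap.lsmul 𝕜 𝕜 : 𝕜 →L[𝕜] E →L[𝕜] E).flip‖ ≤ (1 : NNReal) :=
    fun _ => by
      rw [ContinuousLinearMap.opNorm_flip]
      exact ContinuousLinearMap.opNorm_lsmul_le
  have h := (lp.dualPairing p (ENNReal.conjExponent p) _ hB).le_of_opNorm₂_le_of_le
    (lp.norm_dualPairing _ hB) (le_refl ‖x‖) (le_refl ‖α‖)
  rw [lp.dualPairing_apply] at h
  simpa [hv.tsum_eq] using h

/-- A functional `L` is controlled on `E_x(B_{ℓ_q})` by its values at finitely many `x n`, up to an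
error `‖L‖ ε`: this is the precompactness of `E_x(B_{ℓ_q})`. -/
lemma exists_norm_apply_le_sum [CompleteSpace E] (hp : 1 ≤ p) {x : lp (fun _ : ℕ => E) p}
    (hx : x ∈ strongSeq p E) {ε : ℝ} (hε : 0 < ε) :
    ∃ N, ∀ v ∈ seqBallImage 𝕜 p x, ∀ L : StrongDual 𝕜 E,
      ‖L v‖ ≤ ∑ n ∈ Finset.range N, ‖L (x n)‖ + ‖L‖ * ε := by
  obtain ⟨N, hN⟩ := exists_norm_sub_sum_single_le hp hx hε
  refine ⟨N, ?_⟩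
  rintro v ⟨α, hα, hv⟩ L
  set t := x - ∑ n ∈ Finset.range N, lp.single p n (x n) with ht
  have htn : ∀ n, t n = x n - if n ∈ Finset.range N then x n else 0 := fun n => by
    rw [ht, lp.coeFn_sub, Pi.sub_apply, lp.coeFn_sum, Finset.sum_apply]
    simp only [lp.coeFn_single, Finset.sum_pi_single]
  have hfin : HasSum (fun n => if n ∈ Finset.range N then α n • x n else 0)
      (∑ n ∈ Finset.range N, α n • x n) := by
    have := hasSum_sum_of_ne_finset_zero (L := .unconditional ℕ) (s := Finset.range N)
      (f := fun n => if n ∈ Finset.range N then α n • x n else 0) fun n hn => if_neg hn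
    rwa [Finset.sum_congr rfl fun n hn => if_pos hn] at this
  have htail : HasSum (fun n => α n • t n) (v - ∑ n ∈ Finset.range N, α n • x n) := by
    convert! hv.sub hfin using 2 with n
    rw [htn, smul_sub]
    split_ifs <;> simp
  have hw : ‖v - ∑ n ∈ Finset.range N, α n • x n‖ ≤ ε :=
    (norm_le_of_hasSum_smul hp t α htail).trans
      ((mul_le_of_le_one_right (lp.norm_nonneg' t) hα).trans hN)
  have hα1 : ∀ n, ‖α n‖ ≤ 1 := fun n =>
    (lp.norm_apply_le_norm (by simp [ENNReal.conjExponent]) α n).trans hα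
  calc ‖L v‖ = ‖∑ n ∈ Finset.range N, α n * L (x n)
        + L (v - ∑ n ∈ Finset.range N, α n • x n)‖ := by simp [map_sum]
    _ ≤ ∑ n ∈ Finset.range N, ‖L (x n)‖ + ‖L‖ * ε := by
      refine norm_add_le_of_le (norm_sum_le_of_le _ fun n _ => ?_) (L.le_opNorm_of_le hw)
      rw [norm_mul]
      exact mul_le_of_le_one_left (norm_nonneg _) (hα1 n)

end Tail

/-! ### The range of the second adjoint -/

section Bidual

variable {𝕜 : Type*} [RCLike 𝕜] {p : ℝ≥0∞} {X Y : Type*}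
  [NormedAddCommGroup X] [NormedSpace 𝕜 X] [NormedAddCommGroup Y] [NormedSpace 𝕜 Y]

/-- **Helly's theorem**: on finitely many functionals, an element `ξ` of the bidual is approximated
by evaluation at elements of `X` of norm at most `‖ξ‖ + 1`. -/
lemma exists_norm_le_apply_approx {ι : Type*} [Fintype ι] (φ : ι → StrongDual 𝕜 X)
    (ξ : StrongDual 𝕜 (StrongDual 𝕜 X)) {δ : ℝ} (hδ : 0 < δ) :
    ∃ x : X, ‖x‖ ≤ ‖ξ‖ + 1 ∧ ∀ i, ‖φ i x - ξ (φ i)‖ < δ := by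
  classical
  let : NormedSpace ℝ X := NormedSpace.restrictScalars ℝ 𝕜 X
  have : IsScalarTower ℝ 𝕜 X := RestrictScalars.isScalarTower ℝ 𝕜 X
  have hM : 0 < ‖ξ‖ + 1 := by positivity
  let Φ : X →L[𝕜] (ι → 𝕜) := ContinuousLinearMap.pi φ
  let C : Set (ι → 𝕜) := Φ '' Metric.closedBall 0 (‖ξ‖ + 1)
  have hC : Convex ℝ C :=
    (convex_closedBall (0 : X) (‖ξ‖ + 1)).linear_image (Φ.restrictScalars ℝ).toLinearMap
  suffices hmem : (fun i => ξ (φ i)) ∈ closure C by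
    obtain ⟨_, ⟨x, hx, rfl⟩, hd⟩ := Metric.mem_closure_iff.1 hmem δ hδ
    refine ⟨x, by simpa using hx, fun i => ?_⟩
    rw [norm_sub_rev, ← dist_eq_norm]
    exact (dist_pi_lt_iff hδ).1 hd i
  by_contra hnot
  obtain ⟨f, u, hu, hlt⟩ := RCLike.geometric_hahn_banach_closed_point (𝕜 := 𝕜) hC.closure
    isClosed_closure hnot
  -- `f` is a linear combination of coordinates, so `f ∘ Φ` is a combination `ψ` of the `φ i`.
  let ψ : StrongDual 𝕜 X := ∑ i, f (Pi.single i 1) • φ i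
  have hf : ∀ a : ι → 𝕜, f a = ∑ i, f (Pi.single i 1) * a i := fun a => by
    conv_lhs => rw [pi_eq_sum_univ' a]
    simp [map_sum, mul_comm]
  have hψx : ∀ x, f (Φ x) = ψ x := fun x => by rw [hf]; simp [ψ, Φ]
  have hψξ : f (fun i => ξ (φ i)) = ξ ψ := by rw [hf]; simp [ψ, map_sum]
  have hball : ∀ x ∈ Metric.closedBall (0 : X) (‖ξ‖ + 1), ‖ψ x‖ ≤ u := fun x hx => by
    -- Rotate `x` by a unimodular scalar that makes `ψ x` real and nonnegative.
    obtain ⟨c, hc, hcx⟩ := RCLike.exists_norm_eq_mul_self (ψ x)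
    have h := hu (Φ (c • x)) (subset_closure ⟨c • x, by simpa [norm_smul, hc] using hx, rfl⟩)
    rw [hψx, map_smul, smul_eq_mul, ← hcx, RCLike.ofReal_re] at h
    exact h.le
  have hnorm := ψ.opNorm_bound_of_ball_bound hM u hball
  rw [le_div_iff₀ hM] at hnorm
  have h1 : u < ‖ξ ψ‖ := (hψξ ▸ hlt).trans_le (RCLike.re_le_norm _)
  have h2 := ξ.le_opNorm ψ
  nlinarith [norm_nonneg ψ]

/-- If `T*` is `p`-compact, then `T**` takes its values in the canonical image of `Y`. -/
lemma exists_inclusion_eq_bidual_apply [CompleteSpace Y] (hp : 1 ≤ p) {T : X →L[𝕜] Y}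
    (hT : T ∈ dualPCompactOps 𝕜 p X Y) (ξ : StrongDual 𝕜 (StrongDual 𝕜 X)) :
    ∃ y : Y, NormedSpace.inclusionInDoubleDualLi 𝕜 y = ξ.comp (banachAdjoint T) := by
  have hclosed := (NormedSpace.inclusionInDoubleDualLi 𝕜
    (E := Y)).isometry.isUniformInducing.isComplete_range.isClosed
  refine hclosed.closure_subset (Metric.mem_closure_iff.2 fun ε hε => ?_)
  obtain ⟨x, hx, hsub⟩ := hT _ (Metric.isBounded_closedBall (x := 0) (r := 1))
  have hM : 0 < 2 * ‖ξ‖ + 1 := by positivity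
  obtain ⟨N, hN⟩ := exists_norm_apply_le_sum (𝕜 := 𝕜) hp hx
    (ε := ε / (4 * (2 * ‖ξ‖ + 1))) (by positivity)
  have hδ : 0 < ε / (4 * (N + 1)) := by positivity
  obtain ⟨a, ha, hφ⟩ := exists_norm_le_apply_approx (fun n : Finset.range N => x n) ξ hδ
  let L : StrongDual 𝕜 (StrongDual 𝕜 X) := NormedSpace.inclusionInDoubleDualLi 𝕜 a - ξ
  have hL : ‖L‖ ≤ 2 * ‖ξ‖ + 1 := by
    have h := norm_sub_le (NormedSpace.inclusionInDoubleDualLi 𝕜 a) ξ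
    rw [LinearIsometry.norm_map] at h
    exact h.trans (by linarith)
  have hsum : ∑ n ∈ Finset.range N, ‖L (x n)‖ ≤ ε / 4 := by
    calc _ ≤ ∑ n ∈ Finset.range N, ε / (4 * (N + 1)) :=
          Finset.sum_le_sum fun n hn => (hφ ⟨n, hn⟩).le
      _ = N * (ε / (4 * (N + 1))) := by simp
      _ ≤ (N + 1) * (ε / (4 * (N + 1))) := by gcongr; linarith
      _ = ε / 4 := by field_simp
  have hLε : ‖L‖ * (ε / (4 * (2 * ‖ξ‖ + 1))) ≤ ε / 4 := by
    calc _ ≤ (2 * ‖ξ‖ + 1) * (ε / (4 * (2 * ‖ξ‖ + 1))) := by gcongr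
      _ = ε / 4 := by field_simp
  refine ⟨_, ⟨T a, rfl⟩, ?_⟩
  rw [dist_comm, dist_eq_norm]
  have hbound := (NormedSpace.inclusionInDoubleDualLi 𝕜 (T a)
    - ξ.comp (banachAdjoint T)).opNorm_bound_of_ball_bound one_pos (ε / 2) fun g hg => by
      have h := hN _ (hsub ⟨g, hg, rfl⟩) L
      refine le_trans (le_of_eq ?_) (h.trans (by linarith))
      rfl
  rw [div_one] at hbound
  linarith

end Bidual

/-! ### Extension of functionals by a linear operator -/

/-- If `E*` is a `P_λ` space and `X` is a subspace of `Z`, an operator `k : E → X*` of norm at most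
`1` lifts to an operator `E → Z*` of norm at most `λ`, which assigns to `φ` an extension of the
functional `k φ` to `Z`. Up to exchanging the arguments, this extends an operator `X → E*` to `Z`.
The space in which `E*` is complemented lives in the universe of `E*`, so that of `Z` is arbitrary.
-/
lemma IsPSpace.exists_extension {𝕜 : Type*} [RCLike 𝕜] {E X Z : Type*}
    [NormedAddCommGroup E] [NormedSpace 𝕜 E]
    [NormedAddCommGroup X] [NormedSpace 𝕜 X] [NormedAddCommGroup Z] [NormedSpace 𝕜 Z]
    {lam : ℝ} (hE : IsPSpace 𝕜 lam (StrongDual 𝕜 E)) (i : X →ₗᵢ[𝕜] Z)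
    (k : E →L[𝕜] StrongDual 𝕜 X) (hk : ‖k‖ ≤ 1) :
    ∃ V : E →L[𝕜] StrongDual 𝕜 Z, ‖V‖ ≤ lam ∧ ∀ φ x, V φ (i x) = k φ x := by
  let B := {φ : E // ‖φ‖ ≤ 1}
  -- Hahn-Banach extensions of the functionals `k φ` for `φ` in the unit ball of `E`.
  have hext : ∀ φ : B, ∃ g : StrongDual 𝕜 Z, (∀ x, g (i x) = k φ.1 x) ∧ ‖g‖ ≤ 1 := fun φ => by
    obtain ⟨g, hg, hgn⟩ := exists_extension_norm_eq (LinearMap.range i.toLinearMap)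
      ((k φ.1).comp (i.equivRange.symm : _ →L[𝕜] X))
    refine ⟨g, fun x => ?_, ?_⟩
    · simpa using hg (i.equivRange x)
    · rw [hgn]
      refine ContinuousLinearMap.opNorm_le_bound _ zero_le_one fun z => ?_
      have hkφ : ‖k φ.1‖ ≤ 1 := by simpa using k.le_of_opNorm_le_of_le hk φ.2
      refine ((k φ.1).le_of_opNorm_le hkφ _).trans (le_of_eq ?_)
      simp
  choose g hg hgn using hext
  have hgz : ∀ z φ, ‖g φ z‖ ≤ ‖z‖ := fun z φ => by
    simpa using (g φ).le_of_opNorm_le (hgn φ) z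
  let e : Z →L[𝕜] lp (fun _ : B => 𝕜) ∞ := LinearMap.mkContinuous
    { toFun := fun z => ⟨fun φ => g φ z, memℓp_infty ⟨‖z‖, by rintro _ ⟨φ, rfl⟩; exact hgz z φ⟩⟩
      map_add' := fun y z => lp.ext <| funext fun φ => map_add (g φ) y z
      map_smul' := fun c z => lp.ext <| funext fun φ => map_smul (g φ) c z } 1 fun z => by
    rw [one_mul]
    exact lp.norm_le_of_forall_le (norm_nonneg z) (hgz z)
  have he : ‖e‖ ≤ 1 := LinearMap.mkContinuous_norm_le _ zero_le_one _
  have hξ : ∀ (ξ : StrongDual 𝕜 E) (φ : B), ‖ξ φ.1‖ ≤ ‖ξ‖ := fun ξ φ => ξ.unit_le_opNorm _ φ.2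
  let j : StrongDual 𝕜 E →ₗᵢ[𝕜] lp (fun _ : B => 𝕜) ∞ :=
    { toFun := fun ξ => ⟨fun φ => ξ φ.1, memℓp_infty ⟨‖ξ‖, by rintro _ ⟨φ, rfl⟩; exact hξ ξ φ⟩⟩
      map_add' := fun _ _ => rfl
      map_smul' := fun _ _ => rfl
      norm_map' := fun ξ => by
        refine le_antisymm (lp.norm_le_of_forall_le (norm_nonneg ξ) (hξ ξ)) ?_
        have h := ξ.opNorm_bound_of_ball_bound one_pos _ fun φ hφ =>
          lp.norm_apply_le_norm (by simp) (⟨fun φ => ξ φ.1, memℓp_infty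
            ⟨‖ξ‖, by rintro _ ⟨φ, rfl⟩; exact hξ ξ φ⟩⟩ : lp (fun _ : B => 𝕜) ∞)
            ⟨φ, by simpa using hφ⟩
        rwa [div_one] at h }
  obtain ⟨P, hP, hPn⟩ := hE _ j
  refine ⟨(P.comp e).flip, ?_, fun φ x => ?_⟩
  · calc _ = ‖P.comp e‖ := ContinuousLinearMap.opNorm_flip _
      _ ≤ ‖P‖ * ‖e‖ := P.opNorm_comp_le e
      _ ≤ ‖P‖ * 1 := by gcongr
      _ ≤ lam := by rwa [mul_one]
  · have hej : e (i x) = j (k.flip x) := lp.ext <| funext fun φ => hg φ x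
    rw [ContinuousLinearMap.flip_apply, ContinuousLinearMap.comp_apply, hej, hP]
    rfl

/-- An operator `W : Y* → Z*` such that `W g z = g y` for some `y` depending only on `z` is an
adjoint. -/
lemma exists_banachAdjoint_eq {𝕜 : Type*} [RCLike 𝕜] {Y Z : Type*}
    [NormedAddCommGroup Y] [NormedSpace 𝕜 Y] [NormedAddCommGroup Z] [NormedSpace 𝕜 Z]
    (W : StrongDual 𝕜 Y →L[𝕜] StrongDual 𝕜 Z) (hW : ∀ z, ∃ y : Y, ∀ g, g y = W g z) :
    ∃ T : Z →L[𝕜] Y, banachAdjoint T = W := by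
  choose t ht using hW
  have hsep : ∀ {x y : Y}, (∀ g : StrongDual 𝕜 Y, g x = g y) → x = y := fun h =>
    (NormedSpace.inclusionInDoubleDualLi 𝕜 (E := Y)).injective (ContinuousLinearMap.ext h)
  refine ⟨LinearMap.mkContinuous
    { toFun := t
      map_add' := fun x y => hsep fun g => by simp [ht]
      map_smul' := fun c x => hsep fun g => by simp [ht] } ‖W‖ fun z => ?_, ?_⟩
  · refine NormedSpace.norm_le_dual_bound 𝕜 _ (by positivity) fun g => ?_
    calc ‖g (t z)‖ = ‖W g z‖ := by rw [ht]
      _ ≤ ‖W‖ * ‖g‖ * ‖z‖ := (W g).le_of_opNorm_le (W.le_opNorm g) z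
      _ = ‖W‖ * ‖z‖ * ‖g‖ := by ring
  · ext g z
    exact ht z g

/-! ### The extension theorem -/

theorem theoremT3 {𝕜 : Type*} [RCLike 𝕜]
    {X Y Z : Type*}
    [NormedAddCommGroup X] [NormedSpace 𝕜 X] [CompleteSpace X]
    [NormedAddCommGroup Y] [NormedSpace 𝕜 Y] [CompleteSpace Y]
    [NormedAddCommGroup Z] [NormedSpace 𝕜 Z] [CompleteSpace Z]
    (i : X →ₗᵢ[𝕜] Z)
    (lam : ℝ) (hlam : 1 ≤ lam)
    (hX : IsPSpace 𝕜 lam (StrongDual 𝕜 (StrongDual 𝕜 X)))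
    (p : ℝ≥0∞) (hp : 1 ≤ p)
    (T : X →L[𝕜] Y) (hT : T ∈ dualPCompactOps 𝕜 p X Y) :
    ∃ T' ∈ dualPCompactOps 𝕜 p Z Y,
      (∀ x, T' (i x) = T x) ∧ kappaDual p T' ≤ lam * kappaDual p T := by
  obtain ⟨V, hV, hVi⟩ := hX.exists_extension i (ContinuousLinearMap.id 𝕜 (StrongDual 𝕜 X))
    ContinuousLinearMap.norm_id_le
  obtain ⟨T', hT'⟩ := exists_banachAdjoint_eq (V.comp (banachAdjoint T)) fun z => by
    obtain ⟨y, hy⟩ := exists_inclusion_eq_bidual_apply hp hT (V.flip z)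
    exact ⟨y, fun g => congrArg (fun ζ => ζ g) hy⟩
  refine ⟨T', ?_, fun x => ?_, ?_⟩
  · change banachAdjoint T' ∈ pCompactOps 𝕜 p _ _
    rw [hT']
    exact comp_mem_pCompactOps hp _ hT
  · refine (NormedSpace.inclusionInDoubleDualLi 𝕜 (E := Y)).injective
      (ContinuousLinearMap.ext fun g => ?_)
    calc g (T' (i x)) = banachAdjoint T' g (i x) := rfl
      _ = V (banachAdjoint T g) (i x) := by rw [hT']; rfl
      _ = g (T x) := hVi _ x
  · change kappa p (banachAdjoint T') ≤ _
    rw [hT']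
    exact kappa_comp_le hp _ (zero_lt_one.trans_le hlam) hV hT
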